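/- A $\Sigma\Pi\Sigma\Pi$ circuit over a commutative ring $R$ is an arithmetic circuit whose gates are layered into five levels: inputs, each labelled by a variable or by a constant of $R$, at level $0$; multiplication gates at levels $1$ (the bottom multiplication gates) and $3$; addition gates at levels $2$ and $4$. The only gate at level $4$ is the output, every gate takes its arguments from the level just below it (arguments may be repeated), and fan-ins are unbounded. The size of a circuit is its number of gates, inputs included. The fan-in of a multiplication gate is the number of its arguments, counted with multiplicity, where at level $1$ only the variable arguments are counted (constant arguments act as scalar coefficients). Let $\mathrm{Det}_n$ be the determinant of an $n\times n$ matrix of distinct variables. **Corollary.** For every constant $c>0$, the minimal size of a $\Sigma\Pi\Sigma\Pi$ circuit computing $\mathrm{Det}_n$ is $2^{\Theta(\sqrt n\log n)}$ as $n\to\infty$ in each of the following two classes: 1. circuits in which every bottom multiplication gate has fan-in at least $c\sqrt n$; 2. circuits in which every multiplication gate of level $3$ has fan-in at most $c\sqrt n$. Precisely, for each of the two classes there are $a,b>0$ and $N$, depending only on $c$, such that for every $n\ge N$ and every nonzero commutative ring $R$ the class of circuits over $R$ is non-empty and the minimal size $s$ satisfies $2^{a\sqrt n\log n}\le s\le 2^{b\sqrt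 n\log n}$. -/

import Mathlib

/-- A depth-four `ΣΠΣΠ` arithmetic circuit over the ring `R` in the variables `σ`.
It is a directed acyclic (multi)graph whose gates are layered into five levels:
* level 0: input gates, each labelled by a variable (`Sum.inl x`) or a constant (`Sum.inr r`);
* level 1: multiplication gates, whose arguments are input gates;
* level 2: addition gates, whose arguments are gates of level 1;
* level 3: multiplication gates, whose arguments are gates of level 2;
* level 4: the output, an addition gate whose arguments are gates of level 3.
The fan-in of a gate is unbounded; the arguments of a gate form a multiset, so that an arrow
may be repeated. Only input gates have in-degree `0`, and only the output has out-degree `0`. -/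
structure SPSPCircuit (σ R : Type*) where
  /-- number of gates of level 0 -/
  numInput : ℕ
  /-- number of gates of level 1 -/
  numMul₁ : ℕ
  /-- number of gates of level 2 -/
  numAdd₂ : ℕ
  /-- number of gates of level 3 -/
  numMul₃ : ℕ
  /-- labels of the input gates -/
  label : Fin numInput → σ ⊕ R
  /-- arguments of the multiplication gates of level 1 -/
  mul₁ : Fin numMul₁ → Multiset (Fin numInput)
  /-- arguments of the addition gates of level 2 -/
  add₂ : Fin numAdd₂ → Multiset (Fin numMul₁)
  /-- arguments of the multiplication gates of level 3 -/
  mul₃ : Fin numMul₃ → Multiset (Fin numAdd₂)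
  /-- arguments of the output gate -/
  out : Multiset (Fin numMul₃)
  mul₁_ne_zero : ∀ g, mul₁ g ≠ 0
  add₂_ne_zero : ∀ g, add₂ g ≠ 0
  mul₃_ne_zero : ∀ g, mul₃ g ≠ 0
  out_ne_zero : out ≠ 0
  input_used : ∀ i, ∃ g, i ∈ mul₁ g
  mul₁_used : ∀ i, ∃ g, i ∈ add₂ g
  add₂_used : ∀ i, ∃ g, i ∈ mul₃ g
  mul₃_used : ∀ i, i ∈ out

namespace SPSPCircuit

variable {σ R : Type*}

/-- The size of a circuit: its number of gates, input gates and output gate included. -/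
def size (C : SPSPCircuit σ R) : ℕ :=
  C.numInput + C.numMul₁ + C.numAdd₂ + C.numMul₃ + 1

/-- The fan-in of a bottom (level 1) multiplication gate: the number of its arguments, with
multiplicity, that are variables. Constant arguments are scalar coefficients and do not count
(otherwise a fan-in could be made arbitrarily large by multiplying with the constant `1`). -/
def bottomFanIn (C : SPSPCircuit σ R) (g : Fin C.numMul₁) : ℕ :=
  (C.mul₁ g).countP fun i => (C.label i).isLeft

/-- The fan-in of a multiplication gate of level 3: the number of its arguments, with
multiplicity. -/
def level3FanIn (C : SPSPCircuit σ R) (g : Fin C.numMul₃) : ℕ :=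
  (C.mul₃ g).card

variable [CommRing R]

/-- The polynomial computed by an input gate. -/
noncomputable def evalInput (C : SPSPCircuit σ R) (i : Fin C.numInput) : MvPolynomial σ R :=
  Sum.elim MvPolynomial.X MvPolynomial.C (C.label i)

/-- The polynomial computed by a gate of level 1. -/
noncomputable def evalMul₁ (C : SPSPCircuit σ R) (g : Fin C.numMul₁) : MvPolynomial σ R :=
  ((C.mul₁ g).map C.evalInput).prod

/-- The polynomial computed by a gate of level 2. -/
noncomputable def evalAdd₂ (C : SPSPCircuit σ R) (g : Fin C.numAdd₂) : MvPolynomial σ R :=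
  ((C.add₂ g).map C.evalMul₁).sum

/-- The polynomial computed by a gate of level 3. -/
noncomputable def evalMul₃ (C : SPSPCircuit σ R) (g : Fin C.numMul₃) : MvPolynomial σ R :=
  ((C.mul₃ g).map C.evalAdd₂).prod

/-- The polynomial computed by the circuit, i.e. by its output gate. -/
noncomputable def eval (C : SPSPCircuit σ R) : MvPolynomial σ R :=
  (C.out.map C.evalMul₃).sum

end SPSPCircuit

/-- The polynomial `Det_n`: the determinant of the `n × n` matrix of distinct variables. -/
noncomputable def detPoly (n : ℕ) (R : Type*) [CommRing R] :
    MvPolynomial (Fin n × Fin n) R :=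
  (Matrix.mvPolynomialX (Fin n) (Fin n) R).det

/-- The sizes of the `ΣΠΣΠ` circuits over `R` that compute `Det_n` and in which every bottom
multiplication gate has fan-in at least `t`. -/
def detSizesBottomGE (n : ℕ) (R : Type*) [CommRing R] (t : ℝ) : Set ℕ :=
  {s | ∃ C : SPSPCircuit (Fin n × Fin n) R, C.eval = detPoly n R ∧
    (∀ g, t ≤ (C.bottomFanIn g : ℝ)) ∧ C.size = s}

/-- The sizes of the `ΣΠΣΠ` circuits over `R` that compute `Det_n` and in which every
multiplication gate of level 3 has fan-in at most `v`. -/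
def detSizesLevel3LE (n : ℕ) (R : Type*) [CommRing R] (v : ℝ) : Set ℕ :=
  {s | ∃ C : SPSPCircuit (Fin n × Fin n) R, C.eval = detPoly n R ∧
    (∀ g, (C.level3FanIn g : ℝ) ≤ v) ∧ C.size = s}

/-! Lower bounds: a level 1 gate computes a scalar times a monomial, so a level 3 gate of fan-in at
most `V` yields at most `size ^ V` monomials, one for each choice of level 1 gates. All `n!`
monomials of the determinant must occur, whence `n! ≤ size ^ (V + 1)` (`factorial_le_size_pow`).
Here `V` is of order `√n`: by hypothesis in the second class, and by comparing degrees in the first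
(`level3FanIn_mul_le_degree`).

Upper bounds: one circuit serves both classes. The determinant is an entry of the `n`-th power of a
matrix of size `n ^ 2 + 1` with linear entries, applied to a constant vector
(`det_eq_transfer_pow`). The walks counted are clow sequences: signed sequences of closed walks with
increasing heads, where state `(k, v)` records the head and the current vertex. Correctness follows
from `M * adj M = det M • 1` for truncations of `1 - X A`, with no sign-reversing involution.
Cutting the walks into about `√n` blocks of length about `√n` and expanding each block gives depth
four (`isSumProdSumProd_pow`, `exists_circuit_detPoly`). -/

/-! ### A branching program for the determinant. -/

open Polynomial in
/-- The matrix `1 - X • A` whose rows of index `< k` are replaced by those of the identity. -/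
noncomputable def truncRev {R : Type*} [CommRing R] {n : ℕ} (A : Matrix (Fin n) (Fin n) R)
    (k : ℕ) : Matrix (Fin n) (Fin n) R[X] :=
  fun i j => if (i : ℕ) < k then (1 : Matrix (Fin n) (Fin n) R[X]) i j
    else (1 : Matrix (Fin n) (Fin n) R[X]) i j - X * C (A i j)

/-- The transfer matrix of an algebraic branching program for the determinant of `A`. -/
def transfer {R : Type*} [CommRing R] {n : ℕ} (A : Matrix (Fin n) (Fin n) R) :
    Matrix (Option (Fin n × Fin n)) (Option (Fin n × Fin n)) R
  | _, none => 0
  | none, some (j, w) => -A j w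
  | some (k, v), some (j, w) =>
    if v = k then (if k < j then -A j w else 0)
    else if k < v then (if j = k then A v w else 0) else 0

/-- The terminal weights of the branching program `transfer A`. -/
def terminal {n : ℕ} (R : Type*) [CommRing R] : Option (Fin n × Fin n) → R
  | none => 1
  | some (k, v) => if k = v then 1 else 0

/-- The generating functions of the states of the branching program `transfer A`. -/
noncomputable def stateSeries {R : Type*} [CommRing R] {n : ℕ} (A : Matrix (Fin n) (Fin n) R) :
    Option (Fin n × Fin n) → Polynomial R
  | none => (truncRev A 0).det
  | some (k, v) => (truncRev A k).adjugate v k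

section transfer

open Polynomial

variable {R : Type*} [CommRing R] {n : ℕ} (A : Matrix (Fin n) (Fin n) R)

theorem truncRev_zero : (truncRev A 0).det = A.charpolyRev := by
  rw [Matrix.charpolyRev]
  congr 1

theorem truncRev_succ (k : Fin n) :
    (truncRev A k).updateRow k (Pi.single k 1) = truncRev A (k + 1) := by
  ext1 i j
  by_cases h : i = k
  · subst h
    simp [truncRev, Matrix.one_apply, Pi.single_apply, eq_comm]
  · have : (i : ℕ) < k + 1 ↔ (i : ℕ) < k := by
      have : (i : ℕ) ≠ k := fun h' => h (Fin.ext h')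
      omega
    simp [truncRev, h, this]

theorem stateSeries_diag (k : Fin n) :
    stateSeries A (some (k, k)) = (truncRev A (k + 1)).det := by
  rw [stateSeries, Matrix.adjugate_apply, truncRev_succ]

theorem truncRev_mul_stateSeries (k v : Fin n) :
    ∑ w, truncRev A k v w * stateSeries A (some (k, w)) =
      if v = k then (truncRev A k).det else 0 := by
  have := congrFun (congrFun (Matrix.mul_adjugate (truncRev A k)) v) k
  simpa [Matrix.mul_apply, Matrix.one_apply, stateSeries] using this

/-- Row `v` of the truncated matrix is an identity row, so the off-diagonal entry of `M * adj M` is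
this cofactor itself. A walk never goes below its head. -/
theorem stateSeries_of_lt {k v : Fin n} (h : v < k) : stateSeries A (some (k, v)) = 0 := by
  have := truncRev_mul_stateSeries A k v
  simpa [truncRev, h, h.ne, Matrix.one_apply] using this

theorem stateSeries_of_gt {k v : Fin n} (h : k < v) :
    stateSeries A (some (k, v)) = X * ∑ w, C (A v w) * stateSeries A (some (k, w)) := by
  have := truncRev_mul_stateSeries A k v
  have h' : ¬ ((v : ℕ) < k) := by simpa using h.le
  simp only [truncRev, h', h.ne', if_false, sub_mul, Finset.sum_sub_distrib,
    Matrix.one_apply, ite_mul, one_mul, zero_mul, Finset.sum_ite_eq, Finset.mem_univ, if_true] at this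
  rw [Finset.mul_sum, sub_eq_zero.1 this]
  simp only [mul_assoc]

theorem det_truncRev_step (k : Fin n) :
    (truncRev A k).det = (truncRev A (k + 1)).det
      - X * ∑ w, C (A k w) * stateSeries A (some (k, w)) := by
  have := truncRev_mul_stateSeries A k k
  simp only [truncRev, lt_irrefl, if_false, sub_mul, Finset.sum_sub_distrib,
    Matrix.one_apply, ite_mul, one_mul, zero_mul, Finset.sum_ite_eq, Finset.mem_univ, if_true] at this
  rw [stateSeries_diag] at this
  rw [Finset.mul_sum]
  simp only [← mul_assoc]
  exact this.symm

/-- `det_truncRev_step` telescopes down from `k = n`, where the matrix is the identity. The index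
`j` is the head of the next closed walk. -/
theorem det_truncRev (k : ℕ) (hk : k ≤ n) :
    (truncRev A k).det = 1 - X * ∑ j : Fin n, ∑ w,
      if k ≤ (j : ℕ) then C (A j w) * stateSeries A (some (j, w)) else 0 := by
  induction hk using Nat.decreasingInduction with
  | self =>
    have h1 : truncRev A n = 1 := by
      ext1 i j
      simp [truncRev]
    have h2 (j : Fin n) : ¬ n ≤ (j : ℕ) := by simp
    simp [h1, h2]
  | of_succ k hk ih =>
    have hs := det_truncRev_step A ⟨k, hk⟩
    simp only at hs
    rw [hs, ih]
    have (j : Fin n) : (∑ w, if k ≤ (j : ℕ) then C (A j w) * stateSeries A (some (j, w)) else 0)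
        = (∑ w, if k + 1 ≤ (j : ℕ) then C (A j w) * stateSeries A (some (j, w)) else 0)
        + if j = ⟨k, hk⟩ then ∑ w, C (A j w) * stateSeries A (some (j, w)) else 0 := by
      rcases lt_trichotomy (j : ℕ) k with h | h | h
      · have : j ≠ ⟨k, hk⟩ := fun h' => by simp [h'] at h
        simp [this, h.not_ge, show ¬ (k + 1 ≤ (j : ℕ)) by omega]
      · have : j = ⟨k, hk⟩ := Fin.ext h
        subst this
        simp
      · have : j ≠ ⟨k, hk⟩ := fun h' => by simp [h'] at h
        simp [this, h.le, show k + 1 ≤ (j : ℕ) by omega]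
    simp only [this, Finset.sum_add_distrib, Finset.sum_ite_eq', Finset.mem_univ, if_true]
    ring

/-- One step of the program: multiplication by `X` counts steps, so comparing coefficients turns
this linear system into powers of `transfer A`. -/
theorem stateSeries_eq (s : Option (Fin n × Fin n)) :
    stateSeries A s = C (terminal R s) + X * ∑ t, C (transfer A s t) * stateSeries A t := by
  rw [Fintype.sum_option, Fintype.sum_prod_type]
  rcases s with _ | ⟨k, v⟩
  · rw [stateSeries, det_truncRev A 0 (Nat.zero_le _)]
    simp [transfer, terminal, sub_eq_add_neg]
  · rcases lt_trichotomy v k with h | h | h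
    · simp [stateSeries_of_lt A h, transfer, terminal, h.ne, h.ne', h.not_gt]
    · subst h
      rw [stateSeries_diag, det_truncRev A _ v.2]
      simp only [transfer, terminal, if_true, Nat.succ_le_iff, Fin.val_fin_lt, C_0, C_1, zero_mul,
        zero_add, sub_eq_add_neg, ← mul_neg, ← Finset.sum_neg_distrib]
      congr 2
      refine Finset.sum_congr rfl fun j _ => Finset.sum_congr rfl fun w _ => ?_
      split_ifs <;> simp
    · rw [stateSeries_of_gt A h]
      simp [transfer, terminal, h, h.ne, h.ne', apply_ite C, ite_mul]

theorem coeff_stateSeries (m : ℕ) (s : Option (Fin n × Fin n)) :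
    (stateSeries A s).coeff m = ((transfer A ^ m).mulVec (terminal R)) s := by
  induction m generalizing s with
  | zero => rw [stateSeries_eq]; simp
  | succ m ih =>
    rw [stateSeries_eq, coeff_add, coeff_X_mul, coeff_C_succ, zero_add, pow_succ',
      ← Matrix.mulVec_mulVec]
    simp [Matrix.mulVec, dotProduct, ih]

/-- The coefficient of `X ^ n` in `det (1 - X A)` is the constant coefficient of the characteristic
polynomial, that is `(-1) ^ n * det A`; the sign is moved into the terminal weights. -/
theorem det_eq_transfer_pow :
    A.det = ((transfer A ^ n).mulVec (fun s => (-1) ^ n * terminal R s)) none := by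
  have h : (transfer A ^ n).mulVec (fun s => (-1) ^ n * terminal R s) =
      (-1 : R) ^ n • (transfer A ^ n).mulVec (terminal R) := by
    rw [← Matrix.mulVec_smul]; rfl
  rw [h, Pi.smul_apply, ← coeff_stateSeries, stateSeries, truncRev_zero]
  nontriviality R
  rw [← Matrix.reverse_charpoly, reverse, coeff_reflect, Matrix.charpoly_natDegree_eq_dim,
    Fintype.card_fin, revAt_le le_rfl, Nat.sub_self, smul_eq_mul, Matrix.det_eq_sign_charpoly_coeff,
    Fintype.card_fin]

end transfer

/-! ### Counting the monomials of a circuit. -/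

namespace SPSPCircuit

variable {σ R : Type*}

/-- The exponent of the monomial computed by a level 1 gate. -/
noncomputable def exponent (C : SPSPCircuit σ R) (g : Fin C.numMul₁) : σ →₀ ℕ :=
  ((C.mul₁ g).map fun i => Sum.elim (fun x => Finsupp.single x 1) (fun _ => 0) (C.label i)).sum

theorem degree_exponent (C : SPSPCircuit σ R) (g : Fin C.numMul₁) :
    (C.exponent g).degree = C.bottomFanIn g := by
  unfold exponent bottomFanIn
  induction C.mul₁ g using Multiset.induction with
  | empty => simp
  | cons i m ih =>
    rw [Multiset.map_cons, Multiset.sum_cons, map_add, ih, Multiset.countP_cons]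
    rcases C.label i with x | a
    · simp [add_comm]
    · simp

variable [CommRing R]

theorem exists_evalMul₁_eq (C : SPSPCircuit σ R) (g : Fin C.numMul₁) :
    ∃ r : R, C.evalMul₁ g = MvPolynomial.monomial (C.exponent g) r := by
  unfold evalMul₁ exponent
  induction C.mul₁ g using Multiset.induction with
  | empty => exact ⟨1, by simp⟩
  | cons i m ih =>
    obtain ⟨r, hr⟩ := ih
    rw [Multiset.map_cons, Multiset.prod_cons, Multiset.map_cons, Multiset.sum_cons, hr, evalInput]
    rcases C.label i with x | a
    · exact ⟨r, by simp [MvPolynomial.X, MvPolynomial.monomial_mul]⟩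
    · exact ⟨a * r, by simp [MvPolynomial.C_mul_monomial]⟩

theorem exists_mem_support_of_sum {ι : Type*} (m : Multiset ι) (f : ι → MvPolynomial σ R)
    {d : σ →₀ ℕ} (hd : d ∈ (m.map f).sum.support) : ∃ i ∈ m, d ∈ (f i).support := by
  classical
  induction m using Multiset.induction with
  | empty => simp at hd
  | cons i m ih =>
    rw [Multiset.map_cons, Multiset.sum_cons] at hd
    rcases Finset.mem_union.1 (MvPolynomial.support_add hd) with h | h
    · exact ⟨i, Multiset.mem_cons_self _ _, h⟩
    · obtain ⟨j, hj, h'⟩ := ih h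
      exact ⟨j, Multiset.mem_cons_of_mem hj, h'⟩

theorem exists_exponent_of_mem_support_evalAdd₂ (C : SPSPCircuit σ R) (g : Fin C.numAdd₂)
    {d : σ →₀ ℕ} (hd : d ∈ (C.evalAdd₂ g).support) : ∃ i, d = C.exponent i := by
  obtain ⟨i, -, hi⟩ := exists_mem_support_of_sum _ _ hd
  obtain ⟨r, hr⟩ := C.exists_evalMul₁_eq i
  rw [hr] at hi
  exact ⟨i, by simpa using MvPolynomial.support_monomial_subset hi⟩

/-- Expanding the product selects one level 1 gate from each factor; cancellation and zero divisors
can only remove monomials. -/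
theorem exists_exponents_of_mem_support_evalMul₃ (C : SPSPCircuit σ R) (g : Fin C.numMul₃)
    {d : σ →₀ ℕ} (hd : d ∈ (C.evalMul₃ g).support) :
    ∃ e : Fin (C.level3FanIn g) → Fin C.numMul₁, d = ∑ j, C.exponent (e j) := by
  classical
  unfold evalMul₃ at hd
  unfold level3FanIn
  generalize C.mul₃ g = m at hd ⊢
  induction m using Multiset.induction generalizing d with
  | empty =>
    refine ⟨fun j => j.elim0, ?_⟩
    rw [Multiset.map_zero, Multiset.prod_zero, ← MvPolynomial.C_1, ← MvPolynomial.monomial_zero'] at hd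
    exact Finset.mem_singleton.1 (MvPolynomial.support_monomial_subset hd)
  | cons i m ih =>
    rw [Multiset.map_cons, Multiset.prod_cons] at hd
    obtain ⟨a, ha, b, hb, rfl⟩ := Finset.mem_add.1 (MvPolynomial.support_mul _ _ hd)
    obtain ⟨j, rfl⟩ := C.exists_exponent_of_mem_support_evalAdd₂ i ha
    obtain ⟨e, rfl⟩ := ih hb
    rw [Multiset.card_cons]
    exact ⟨Fin.cons j e, by simp [Fin.sum_univ_succ]⟩

/-- If only level 3 gates of fan-in at most `V` contribute to the monomials of `s`, then there are
few such monomials. -/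
theorem card_le_size_pow (C : SPSPCircuit σ R) (s : Finset (σ →₀ ℕ)) (V : ℕ)
    (hs : s ⊆ C.eval.support)
    (hV : ∀ d ∈ s, ∀ g, d ∈ (C.evalMul₃ g).support → C.level3FanIn g ≤ V) :
    s.card ≤ C.size ^ (V + 1) := by
  classical
  have hsub : s ⊆ (Finset.univ.filter fun g => C.level3FanIn g ≤ V).biUnion fun g =>
      Finset.univ.image fun e : Fin (C.level3FanIn g) → Fin C.numMul₁ =>
        ∑ j, C.exponent (e j) := by
    intro d hd
    obtain ⟨g, -, hg⟩ := exists_mem_support_of_sum _ _ (hs hd)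
    obtain ⟨e, he⟩ := C.exists_exponents_of_mem_support_evalMul₃ g hg
    simp only [Finset.mem_biUnion, Finset.mem_filter, Finset.mem_univ, true_and, Finset.mem_image]
    exact ⟨g, hV d hd g hg, e, he.symm⟩
  have hle : C.numMul₃ ≤ C.size ∧ C.numMul₁ ≤ C.size ∧ 0 < C.size := by
    unfold size; omega
  calc s.card ≤ _ := Finset.card_le_card hsub
    _ ≤ (Finset.univ.filter fun g => C.level3FanIn g ≤ V).card * C.size ^ V := by
        refine Finset.card_biUnion_le_card_mul _ _ _ fun g hg => ?_
        refine Finset.card_image_le.trans ?_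
        rw [Finset.card_univ, Fintype.card_fun, Fintype.card_fin, Fintype.card_fin]
        exact (Nat.pow_le_pow_left hle.2.1 _).trans
          (Nat.pow_le_pow_right hle.2.2 (Finset.mem_filter.1 hg).2)
    _ ≤ C.size * C.size ^ V := by
        refine Nat.mul_le_mul_right _ ((Finset.card_filter_le _ _).trans ?_)
        simpa using hle.1
    _ = _ := (pow_succ' _ _).symm

/-- Each factor contributes an exponent of degree at least `t`, so a large bottom fan-in forces a
small level 3 fan-in. -/
theorem level3FanIn_mul_le_degree (C : SPSPCircuit σ R) (t : ℝ)
    (ht : ∀ g, t ≤ (C.bottomFanIn g : ℝ)) (g : Fin C.numMul₃) {d : σ →₀ ℕ}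
    (hd : d ∈ (C.evalMul₃ g).support) : (C.level3FanIn g : ℝ) * t ≤ d.degree := by
  obtain ⟨e, rfl⟩ := C.exists_exponents_of_mem_support_evalMul₃ g hd
  rw [map_sum, Nat.cast_sum]
  have := Finset.card_nsmul_le_sum (Finset.univ : Finset (Fin (C.level3FanIn g)))
    (fun j => ((C.exponent (e j)).degree : ℝ)) t fun j _ => by
      rw [degree_exponent]; exact ht _
  simpa using this

end SPSPCircuit

/-! ### The monomials of the determinant. -/

/-- The exponent of the monomial of `Det_n` that belongs to the permutation `p`. -/
noncomputable def permExponent {n : ℕ} (p : Equiv.Perm (Fin n)) : Fin n × Fin n →₀ ℕ :=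
  ∑ i, Finsupp.single (p i, i) 1

theorem permExponent_injective {n : ℕ} : Function.Injective (permExponent (n := n)) := by
  classical
  intro p q h
  ext1 i
  have := DFunLike.congr_fun h (p i, i)
  by_contra hne
  simp [permExponent, Finsupp.finsetSum_apply, Finsupp.single_apply] at this
  have h0 : ∀ j, ¬ (q j = p i ∧ j = i) := fun j hj => hne (by rw [← hj.1, hj.2])
  simp [h0] at this

theorem degree_permExponent {n : ℕ} (p : Equiv.Perm (Fin n)) : (permExponent p).degree = n := by
  simp [permExponent, map_sum]

theorem permExponent_mem_support {n : ℕ} (R : Type*) [CommRing R] [Nontrivial R]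
    (p : Equiv.Perm (Fin n)) : permExponent p ∈ (detPoly n R).support := by
  classical
  have h (q : Equiv.Perm (Fin n)) :
      ∏ i, Matrix.mvPolynomialX (Fin n) (Fin n) R (q i) i
        = MvPolynomial.monomial (permExponent q) (1 : R) := by
    simp [permExponent, MvPolynomial.monomial_sum_one, MvPolynomial.X]
  rw [MvPolynomial.mem_support_iff, detPoly, Matrix.det_apply]
  simp only [h, MvPolynomial.coeff_sum, Units.smul_def, MvPolynomial.coeff_smul, MvPolynomial.coeff_monomial,
    permExponent_injective.eq_iff, smul_ite, smul_zero, Finset.sum_ite_eq', Finset.mem_univ, if_true]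
  rcases Int.units_eq_one_or (Equiv.Perm.sign p) with h | h <;> simp [h]

/-- The fan-in is bounded only for gates containing a monomial of degree `n`: in the first class,
other gates may have a larger fan-in if their outputs cancel. -/
theorem factorial_le_size_pow {n : ℕ} {R : Type*} [CommRing R] [Nontrivial R]
    (C : SPSPCircuit (Fin n × Fin n) R) (hC : C.eval = detPoly n R) (V : ℕ)
    (hV : ∀ d : Fin n × Fin n →₀ ℕ, d.degree = n → ∀ g, d ∈ (C.evalMul₃ g).support →
      C.level3FanIn g ≤ V) : n.factorial ≤ C.size ^ (V + 1) := by
  classical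
  have := C.card_le_size_pow (Finset.univ.image (permExponent (n := n))) V
    (fun d hd => by
      obtain ⟨p, -, rfl⟩ := Finset.mem_image.1 hd
      rw [hC]; exact permExponent_mem_support R p)
    (fun d hd => by
      obtain ⟨p, -, rfl⟩ := Finset.mem_image.1 hd
      exact hV _ (degree_permExponent p))
  rwa [Finset.card_image_of_injective _ permExponent_injective, Finset.card_univ,
    Fintype.card_perm, Fintype.card_fin] at this

/-! ### Depth-four circuits from matrix powers. -/

section UpperBound

open MvPolynomial

variable {σ R : Type*} [CommRing R]

/-- The polynomial computed by a product of variables and constants. -/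
noncomputable def termEval (l : List (σ ⊕ R)) : MvPolynomial σ R :=
  (l.map (Sum.elim X C)).prod

/-- `f` is a non-empty sum of at most `m` products, each of at most `q` variables and constants,
among which at least `d` variables. -/
def IsSumProd (d m q : ℕ) (f : MvPolynomial σ R) : Prop :=
  ∃ (P : Type) (_ : Fintype P) (_ : Nonempty P) (T : P → List (σ ⊕ R)),
    Fintype.card P ≤ m ∧ (∀ p, d ≤ (T p).countP (·.isLeft) ∧ (T p).length ≤ q) ∧
    f = ∑ p, termEval (T p)

/-- `f` is a non-empty sum of at most `k` products of `b` polynomials satisfying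
`IsSumProd d m q`. -/
def IsSumProdSumProd (k b d m q : ℕ) (f : MvPolynomial σ R) : Prop :=
  ∃ (K : Type) (_ : Fintype K) (_ : Nonempty K) (F : K → Fin b → MvPolynomial σ R),
    Fintype.card K ≤ k ∧ (∀ x i, IsSumProd d m q (F x i)) ∧ f = ∑ x, ∏ i, F x i

theorem IsSumProd.mono {d m q d' m' q' : ℕ} {f : MvPolynomial σ R} (h : IsSumProd d m q f)
    (hd : d' ≤ d) (hm : m ≤ m') (hq : q ≤ q') : IsSumProd d' m' q' f := by
  obtain ⟨P, i1, i2, T, h1, h2, h3⟩ := h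
  exact ⟨P, i1, i2, T, h1.trans hm, fun p => ⟨hd.trans (h2 p).1, (h2 p).2.trans hq⟩, h3⟩

theorem card_sigma_le {ι : Type*} [Fintype ι] {P : ι → Type*} [∀ i, Fintype (P i)] {k m : ℕ}
    (hk : Fintype.card ι ≤ k) (hm : ∀ i, Fintype.card (P i) ≤ m) :
    Fintype.card (Σ i, P i) ≤ k * m := by
  rw [Fintype.card_sigma]
  refine (Finset.sum_le_card_nsmul _ _ m fun i _ => hm i).trans ?_
  rw [smul_eq_mul]
  exact Nat.mul_le_mul_right _ hk

theorem IsSumProd.sum {S : Type} [Fintype S] [Nonempty S] {d m q : ℕ}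
    {f : S → MvPolynomial σ R} (h : ∀ s, IsSumProd d m q (f s)) :
    IsSumProd d (Fintype.card S * m) q (∑ s, f s) := by
  choose P i1 i2 T h1 h2 h3 using h
  exact ⟨Σ s, P s, inferInstance, nonempty_sigma.2 ⟨Classical.arbitrary S, i2 _⟩, fun x => T x.1 x.2, card_sigma_le le_rfl h1,
    fun x => h2 x.1 x.2, by rw [Fintype.sum_sigma]; exact Finset.sum_congr rfl fun s _ => h3 s⟩

theorem isSumProd_C (r : R) : IsSumProd 0 1 1 (C r : MvPolynomial σ R) :=
  ⟨Unit, inferInstance, inferInstance, fun _ => [Sum.inr r], by simp, by simp, by simp [termEval]⟩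

theorem IsSumProd.C_mul_X_mul {d m q : ℕ} {f : MvPolynomial σ R} (h : IsSumProd d m q f)
    (r : R) (x : σ) : IsSumProd (d + 1) m (q + 2) (C r * X x * f) := by
  obtain ⟨P, i1, i2, T, h1, h2, h3⟩ := h
  refine ⟨P, i1, i2, fun p => Sum.inr r :: Sum.inl x :: T p, h1, fun p => ?_, ?_⟩
  · have := h2 p
    rw [List.countP_cons_of_neg (by simp), List.countP_cons_of_pos (by simp)]
    simp [this]
  · rw [h3, Finset.mul_sum]
    simp [termEval, mul_assoc]

theorem IsSumProdSumProd.sum_mul {S : Type} [Fintype S] [Nonempty S] {k b d m q : ℕ}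
    {f g : S → MvPolynomial σ R} (hg : ∀ s, IsSumProd d m q (g s))
    (hf : ∀ s, IsSumProdSumProd k b d m q (f s)) :
    IsSumProdSumProd (Fintype.card S * k) (b + 1) d m q (∑ s, g s * f s) := by
  choose K i1 i2 F h1 h2 h3 using hf
  refine ⟨Σ s, K s, inferInstance, nonempty_sigma.2 ⟨Classical.arbitrary S, i2 _⟩,
    fun x => Fin.cons (α := fun _ => MvPolynomial σ R) (g x.1) (F x.1 x.2),
    card_sigma_le le_rfl h1, fun x => Fin.cases (hg x.1) (h2 x.1 x.2), ?_⟩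
  rw [Fintype.sum_sigma]
  refine Finset.sum_congr rfl fun s _ => ?_
  simp only [Fin.prod_univ_succ, Fin.cons_zero, Fin.cons_succ, ← Finset.mul_sum]
  rw [h3 s]

theorem IsSumProd.isSumProdSumProd {d m q : ℕ} {f : MvPolynomial σ R} (h : IsSumProd d m q f) :
    IsSumProdSumProd 1 1 d m q f :=
  ⟨Unit, inferInstance, inferInstance, fun _ _ => f, by simp, fun _ _ => h, by simp⟩

/-- A sum over walks of length `l`. Each step adds a coefficient and a variable, and the terminal
weight adds the final constant, hence `2 * l + 1`. -/
theorem isSumProd_pow_mulVec {S : Type} [Fintype S] [Nonempty S] [DecidableEq S]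
    (N : Matrix S S (MvPolynomial σ R)) (hN : ∀ s t, ∃ r x, N s t = C r * X x)
    (v : S → R) (l : ℕ) (s : S) :
    IsSumProd l (Fintype.card S ^ l) (2 * l + 1) ((N ^ l).mulVec (fun t => C (v t)) s) := by
  induction l generalizing s with
  | zero => simpa using isSumProd_C (v s)
  | succ l ih =>
    rw [pow_succ' N, ← Matrix.mulVec_mulVec, pow_succ']
    refine IsSumProd.sum fun t => ?_
    obtain ⟨r, x, h⟩ := hN s t
    have h' := (ih t).C_mul_X_mul r x
    rwa [← h] at h'

theorem isSumProd_pow {S : Type} [Fintype S] [Nonempty S] [DecidableEq S]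
    (N : Matrix S S (MvPolynomial σ R)) (hN : ∀ s t, ∃ r x, N s t = C r * X x)
    (l : ℕ) (s t : S) :
    IsSumProd l (Fintype.card S ^ l) (2 * l + 1) ((N ^ l) s t) := by
  have h := isSumProd_pow_mulVec N hN (Pi.single t 1) l s
  have h' : (fun u => C (Pi.single (M := fun _ => R) t 1 u) : S → MvPolynomial σ R)
      = Pi.single t 1 := by
    ext1 u
    by_cases hu : u = t
    · subst hu; simp
    · simp [hu]
  rwa [h', Matrix.mulVec_single_one] at h

/-- A product of `b + 1` blocks of at least `d` matrices with linear entries. -/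
theorem isSumProdSumProd_pow {S : Type} [Fintype S] [Nonempty S] [DecidableEq S]
    (N : Matrix S S (MvPolynomial σ R)) (hN : ∀ s t, ∃ r x, N s t = C r * X x)
    (v : S → R) (d r b : ℕ) (s : S) :
    IsSumProdSumProd (Fintype.card S ^ b) (b + 1) d (Fintype.card S ^ (d + r)) (2 * (d + r) + 1)
      ((N ^ (d * (b + 1) + r)).mulVec (fun t => C (v t)) s) := by
  induction b generalizing s with
  | zero =>
    rw [zero_add, mul_one, pow_zero]
    -- The last block absorbs the remainder `r`, so no block is shorter than `d`.
    exact ((isSumProd_pow_mulVec N hN v (d + r) s).mono (Nat.le_add_right _ _) le_rfl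
      le_rfl).isSumProdSumProd
  | succ b ih =>
    have : d * (b + 1 + 1) + r = d + (d * (b + 1) + r) := by ring
    rw [this, pow_add N, ← Matrix.mulVec_mulVec, pow_succ']
    exact IsSumProdSumProd.sum_mul (fun t => (isSumProd_pow N hN d s t).mono le_rfl
      (Nat.pow_le_pow_right Fintype.card_pos (Nat.le_add_right _ _)) (by omega)) ih

theorem univ_val_map_get {α : Type*} (l : List α) :
    (Finset.univ : Finset (Fin l.length)).val.map l.get = (l : Multiset α) := by
  rw [Fin.univ_val_map, List.ofFn_get]

/-- The circuit is a tree without sharing, its gates indexed by nested sigma types. Positivity of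
`b` and `d` ensures that no multiplication gate is empty. -/
theorem IsSumProdSumProd.exists_circuit {k b d m q : ℕ} {f : MvPolynomial σ R}
    (h : IsSumProdSumProd k b d m q f) (hb : 0 < b) (hd : 0 < d) :
    ∃ C : SPSPCircuit σ R, C.eval = f ∧ (∀ g, d ≤ C.bottomFanIn g) ∧
      (∀ g, C.level3FanIn g = b) ∧
      C.size ≤ k * b * m * q + k * b * m + k * b + k + 1 := by
  obtain ⟨K, _, _, F, hk, hF, rfl⟩ := h
  choose P i1 i2 T h1 h2 h3 using hF
  have : Nonempty (Fin b) := ⟨⟨0, hb⟩⟩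
  have hlen (x i p) : 0 < (T x i p).length := (hd.trans_le (h2 x i p).1).trans_le List.countP_le_length
  let L₁ := Σ y : K × Fin b, P y.1 y.2
  let L₀ := Σ z : L₁, Fin (T z.1.1 z.1.2 z.2).length
  let e₀ := Fintype.equivFin L₀
  let e₁ := Fintype.equivFin L₁
  let e₂ := Fintype.equivFin (K × Fin b)
  let e₃ := Fintype.equivFin K
  let lab : L₀ → σ ⊕ R := fun w => (T w.1.1.1 w.1.1.2 w.1.2).get w.2
  let D : SPSPCircuit σ R :=
    { numInput := Fintype.card L₀
      numMul₁ := Fintype.card L₁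
      numAdd₂ := Fintype.card (K × Fin b)
      numMul₃ := Fintype.card K
      label := fun i => lab (e₀.symm i)
      mul₁ := fun g => Finset.univ.val.map fun j => e₀ ⟨e₁.symm g, j⟩
      add₂ := fun g => Finset.univ.val.map fun p => e₁ ⟨e₂.symm g, p⟩
      mul₃ := fun g => Finset.univ.val.map fun i => e₂ (e₃.symm g, i)
      out := Finset.univ.val
      mul₁_ne_zero := fun g => by
        rw [← Multiset.card_pos, Multiset.card_map, Finset.card_val, Finset.card_univ,
          Fintype.card_fin]
        exact hlen _ _ _
      add₂_ne_zero := fun g => by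
        rw [← Multiset.card_pos, Multiset.card_map, Finset.card_val, Finset.card_univ]
        exact Fintype.card_pos
      mul₃_ne_zero := fun g => by
        rw [← Multiset.card_pos, Multiset.card_map, Finset.card_val, Finset.card_univ]
        exact Fintype.card_pos
      out_ne_zero := by
        rw [← Multiset.card_pos, Finset.card_val, Finset.card_univ, Fintype.card_fin]
        exact Fintype.card_pos
      input_used := fun i => by
        obtain ⟨w, rfl⟩ := e₀.surjective i
        refine ⟨e₁ w.1, Multiset.mem_map.2 ?_⟩
        rw [Equiv.symm_apply_apply]
        exact ⟨w.2, Finset.mem_univ_val _, rfl⟩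
      mul₁_used := fun i => by
        obtain ⟨w, rfl⟩ := e₁.surjective i
        refine ⟨e₂ w.1, Multiset.mem_map.2 ?_⟩
        rw [Equiv.symm_apply_apply]
        exact ⟨w.2, Finset.mem_univ_val _, rfl⟩
      add₂_used := fun i => by
        obtain ⟨w, rfl⟩ := e₂.surjective i
        refine ⟨e₃ w.1, Multiset.mem_map.2 ?_⟩
        rw [Equiv.symm_apply_apply]
        exact ⟨w.2, Finset.mem_univ_val _, rfl⟩
      mul₃_used := fun i => Finset.mem_univ i }
  have hmul (z : L₁) : (D.mul₁ (e₁ z)).map D.label =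
      (T z.1.1 z.1.2 z.2 : Multiset (σ ⊕ R)) := by
    have : D.mul₁ (e₁ z) = Finset.univ.val.map fun j => e₀ ⟨z, j⟩ := by
      simp only [D]
      rw [e₁.symm_apply_apply]
    have hlab (w : L₀) : D.label (e₀ w) = lab w := congrArg lab (e₀.symm_apply_apply w)
    rw [this, Multiset.map_map]
    simp only [Function.comp_def, hlab]
    exact univ_val_map_get _
  have hE₁ (z : L₁) : D.evalMul₁ (e₁ z) = termEval (T z.1.1 z.1.2 z.2) := by
    have : D.evalMul₁ (e₁ z) = (((D.mul₁ (e₁ z)).map D.label).map (Sum.elim X C)).prod := by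
      rw [Multiset.map_map]; rfl
    rw [this, hmul, termEval, Multiset.map_coe, Multiset.prod_coe]
  have hE₂ (y : K × Fin b) : D.evalAdd₂ (e₂ y) = F y.1 y.2 := by
    have : D.add₂ (e₂ y) = Finset.univ.val.map fun p => e₁ ⟨y, p⟩ := by
      simp only [D]
      rw [e₂.symm_apply_apply]
    rw [SPSPCircuit.evalAdd₂, this, Multiset.map_map]
    simp only [Function.comp_def, hE₁]
    exact (h3 y.1 y.2).symm
  have hE₃ (x : K) : D.evalMul₃ (e₃ x) = ∏ i, F x i := by
    have : D.mul₃ (e₃ x) = Finset.univ.val.map fun i => e₂ (x, i) := by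
      simp only [D]
      rw [e₃.symm_apply_apply]
    rw [SPSPCircuit.evalMul₃, this, Multiset.map_map]
    simp only [Function.comp_def, hE₂]
    rfl
  refine ⟨D, ?_, fun g => ?_, fun g => ?_, ?_⟩
  · rw [← Fintype.sum_equiv e₃.symm (fun g => D.evalMul₃ g) _ fun g => by
      rw [← hE₃, e₃.apply_symm_apply]]
    rfl
  · obtain ⟨z, rfl⟩ := e₁.surjective g
    refine (h2 z.1.1 z.1.2 z.2).1.trans (le_of_eq ?_)
    have := congrArg (Multiset.countP fun x => x.isLeft = true) (hmul z)
    rw [Multiset.countP_map, Multiset.coe_countP] at this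
    rw [SPSPCircuit.bottomFanIn, Multiset.countP_eq_card_filter, this]
    simp
  · simp [SPSPCircuit.level3FanIn, D]
  · have c₂ : Fintype.card (K × Fin b) ≤ k * b := by
      rw [Fintype.card_prod, Fintype.card_fin]
      exact Nat.mul_le_mul_right _ hk
    have c₁ : Fintype.card L₁ ≤ k * b * m := card_sigma_le c₂ fun y => h1 y.1 y.2
    have c₀ : Fintype.card L₀ ≤ k * b * m * q := card_sigma_le c₁ fun z => by
      rw [Fintype.card_fin]; exact (h2 z.1.1 z.1.2 z.2).2
    simp only [SPSPCircuit.size, D]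
    omega

theorem detPoly_eq_mulVec (n : ℕ) (R : Type*) [CommRing R] :
    detPoly n R = ((transfer (Matrix.mvPolynomialX (Fin n) (Fin n) R) ^ n).mulVec
      (fun s => C ((-1) ^ n * terminal R s))) none := by
  rw [detPoly, det_eq_transfer_pow]
  congr 2
  ext1 s
  rcases s with _ | ⟨k, v⟩
  · simp [terminal]
  · simp [terminal, apply_ite C]

theorem transfer_mvPolynomialX_eq {n : ℕ} (hn : 0 < n) (R : Type*) [CommRing R]
    (s t : Option (Fin n × Fin n)) :
    ∃ (r : R) (x : Fin n × Fin n),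
      transfer (Matrix.mvPolynomialX (Fin n) (Fin n) R) s t = C r * X x := by
  -- Even a zero entry is written with a variable, so that every walk keeps its full bottom fan-in.
  have h0 : ∃ (r : R) (x : Fin n × Fin n), (0 : MvPolynomial (Fin n × Fin n) R) = C r * X x :=
    ⟨0, (⟨0, hn⟩, ⟨0, hn⟩), by simp⟩
  have hpos (i j : Fin n) : ∃ (r : R) (x : Fin n × Fin n),
      Matrix.mvPolynomialX (Fin n) (Fin n) R i j = C r * X x := ⟨1, (i, j), by simp⟩
  have hneg (i j : Fin n) : ∃ (r : R) (x : Fin n × Fin n),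
      -Matrix.mvPolynomialX (Fin n) (Fin n) R i j = C r * X x := ⟨-1, (i, j), by simp⟩
  rcases t with _ | ⟨j, w⟩
  · rcases s with _ | ⟨k, v⟩ <;> simpa only [transfer] using h0
  · rcases s with _ | ⟨k, v⟩
    · simpa only [transfer] using hneg j w
    · simp only [transfer]
      split_ifs
      exacts [hneg j w, h0, hpos v w, h0, h0]

/-- A `ΣΠΣΠ` circuit for `Det_n` with `n / t` blocks of length at least `t`. -/
theorem exists_circuit_detPoly {n t : ℕ} (ht : 0 < t) (htn : t ≤ n) (R : Type*) [CommRing R] :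
    ∃ D : SPSPCircuit (Fin n × Fin n) R, D.eval = detPoly n R ∧ (∀ g, t ≤ D.bottomFanIn g) ∧
      (∀ g, D.level3FanIn g = n / t) ∧
      D.size ≤ 25 * n ^ 2 * (n ^ 2 + 1) ^ (n / t + 2 * t) := by
  have hb : 0 < n / t := Nat.div_pos htn ht
  have hn : 0 < n := ht.trans_le htn
  have hq : n / t - 1 + 1 = n / t := Nat.sub_add_cancel hb
  have h := isSumProdSumProd_pow _ (transfer_mvPolynomialX_eq hn R)
    (fun s => (-1) ^ n * terminal R s) t (n % t) (n / t - 1) none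
  rw [hq, Nat.div_add_mod, ← detPoly_eq_mulVec] at h
  obtain ⟨D, h1, h2, h3, h4⟩ := h.exists_circuit hb ht
  refine ⟨D, h1, h2, h3, h4.trans ?_⟩
  have hc : Fintype.card (Option (Fin n × Fin n)) = n ^ 2 + 1 := by simp [sq]
  rw [hc]
  have hmod : n % t < t := Nat.mod_lt _ ht
  have hS : 0 < n ^ 2 + 1 := Nat.succ_pos _
  have hpow : (n ^ 2 + 1) ^ (n / t - 1) * (n ^ 2 + 1) ^ (t + n % t)
      ≤ (n ^ 2 + 1) ^ (n / t + 2 * t) := by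
    rw [← pow_add]
    exact Nat.pow_le_pow_right hS (by omega)
  set k := (n ^ 2 + 1) ^ (n / t - 1)
  set m := (n ^ 2 + 1) ^ (t + n % t)
  set q := 2 * (t + n % t) + 1
  have hk : 0 < k := pow_pos hS _
  have hm : 0 < m := pow_pos hS _
  have hq' : q ≤ 5 * n := by omega
  have hq0 : 0 < q := Nat.succ_pos _
  have hbn : n / t ≤ n := Nat.div_le_self _ _
  have a1 : k ≤ k * (n / t) := Nat.le_mul_of_pos_right _ hb
  have a2 : k * (n / t) ≤ k * (n / t) * m := Nat.le_mul_of_pos_right _ hm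
  have a3 : k * (n / t) * m ≤ k * (n / t) * m * q := Nat.le_mul_of_pos_right _ hq0
  -- Each of the five summands of the size bound is at most the first one; with `q ≤ 5 * n` this
  -- gives the factor 25.
  calc _ ≤ 5 * (k * (n / t) * m * q) := by omega
    _ ≤ 5 * (k * n * m * (5 * n)) := by gcongr
    _ = 25 * n ^ 2 * (k * m) := by ring
    _ ≤ _ := by gcongr

end UpperBound

/-! ### Asymptotic estimates and conclusion. -/

theorem two_rpow_le_of_factorial_le {K : ℝ} (hK : 0 < K) {n s V : ℕ} (hn : 9 ≤ n)
    (hV : (V : ℝ) ≤ K * √(n : ℝ)) (hs0 : 0 < s) (hs : n.factorial ≤ s ^ (V + 1)) :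
    (2 : ℝ) ^ (1 / (2 * (K + 1)) * (√(n : ℝ) * Real.log n)) ≤ s := by
  have hn' : (9 : ℝ) ≤ n := by exact_mod_cast hn
  -- Since `9 > e ^ 2`, this gives `n log n - n ≥ (n log n) / 2`, the source of the 2 in the
  -- exponent's denominator.
  have hlog : 2 ≤ Real.log n := by
    rw [Real.le_log_iff_exp_le (by linarith)]
    have := Real.exp_one_lt_d9
    have h2 : Real.exp 2 = Real.exp 1 * Real.exp 1 := by rw [← Real.exp_add]; norm_num
    nlinarith [Real.exp_pos 1]
  have hr1 : 1 ≤ √(n : ℝ) := by rw [Real.one_le_sqrt]; linarith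
  have hrr : √(n : ℝ) * √(n : ℝ) = n := Real.mul_self_sqrt (by linarith)
  have hs1 : (1 : ℝ) ≤ s := by exact_mod_cast hs0
  have hls : 0 ≤ Real.log s := Real.log_nonneg hs1
  have h1 : (n : ℝ) * Real.log n - n ≤ Real.log n.factorial := by
    have h := Real.pow_div_factorial_le_exp (n : ℝ) (by linarith) n
    have hf : (0 : ℝ) < n.factorial := by exact_mod_cast n.factorial_pos
    have h' := Real.log_le_log (by positivity) h
    rw [Real.log_exp, Real.log_div (by positivity) hf.ne', Real.log_pow] at h'
    linarith
  have h2 : Real.log n.factorial ≤ (V + 1) * Real.log s := by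
    have h : (n.factorial : ℝ) ≤ (s : ℝ) ^ (V + 1) := by exact_mod_cast hs
    have h' := Real.log_le_log (by exact_mod_cast n.factorial_pos) h
    rw [Real.log_pow] at h'
    exact_mod_cast h'
  have h3 : (V + 1) * Real.log s ≤ (K + 1) * √(n : ℝ) * Real.log s :=
    mul_le_mul_of_nonneg_right (by nlinarith) hls
  have h4 : √(n : ℝ) * (√(n : ℝ) * Real.log n) ≤ √(n : ℝ) * (2 * (K + 1) * Real.log s) := by
    rw [← mul_assoc, hrr]
    nlinarith
  have h5 : 1 / (2 * (K + 1)) * (√(n : ℝ) * Real.log n) ≤ Real.log s := by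
    rw [one_div_mul_eq_div, div_le_iff₀' (by linarith)]
    exact le_of_mul_le_mul_left h4 (by linarith)
  calc (2 : ℝ) ^ (1 / (2 * (K + 1)) * (√(n : ℝ) * Real.log n))
      ≤ (2 : ℝ) ^ Real.log s := Real.rpow_le_rpow_of_exponent_le (by norm_num) h5
    _ ≤ Real.exp 1 ^ Real.log s :=
        Real.rpow_le_rpow (by norm_num) (by linarith [Real.exp_one_gt_d9]) hls
    _ = s := by rw [← Real.exp_mul, one_mul, Real.exp_log (by linarith)]

theorem exists_circuit_detPoly_sqrt {K : ℝ} (hK : 1 ≤ K) {n : ℕ} (hn : 25 ≤ n)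
    (hnK : 4 * K ^ 2 ≤ n) (R : Type*) [CommRing R] :
    ∃ D : SPSPCircuit (Fin n × Fin n) R, D.eval = detPoly n R ∧
      (∀ g, K * √(n : ℝ) ≤ D.bottomFanIn g) ∧
      (∀ g, (D.level3FanIn g : ℝ) ≤ 1 / K * √(n : ℝ)) ∧
      (D.size : ℝ) ≤ (2 : ℝ) ^ ((12 + 24 * K) * (√(n : ℝ) * Real.log n)) := by
  have hn' : (25 : ℝ) ≤ n := by exact_mod_cast hn
  have hr1 : 1 ≤ √(n : ℝ) := by rw [Real.one_le_sqrt]; linarith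
  have hrr : √(n : ℝ) * √(n : ℝ) = n := Real.mul_self_sqrt (by linarith)
  have hKr : 2 * K ≤ √(n : ℝ) := Real.le_sqrt_of_sq_le (by linarith [mul_pow 2 K 2])
  have hKpos : 0 < K * √(n : ℝ) := by positivity
  -- Blocks of this length have at least `K √n` variables each, and there are at most `√n / K` of
  -- them.
  set t := ⌈K * √(n : ℝ)⌉₊ with ht
  have ht0 : 0 < t := Nat.ceil_pos.2 hKpos
  have htl : K * √(n : ℝ) ≤ t := Nat.le_ceil _
  have htu : (t : ℝ) ≤ 2 * K * √(n : ℝ) := by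
    have := (Nat.ceil_lt_add_one hKpos.le).le
    nlinarith
  have htn : t ≤ n := by
    have : (t : ℝ) ≤ n := htu.trans (by nlinarith)
    exact_mod_cast this
  have hb : ((n / t : ℕ) : ℝ) ≤ 1 / K * √(n : ℝ) := by
    refine Nat.cast_div_le.trans ?_
    rw [div_le_iff₀ (by exact_mod_cast ht0)]
    calc (n : ℝ) = 1 / K * √(n : ℝ) * (K * √(n : ℝ)) := by
          rw [mul_mul_mul_comm, one_div_mul_cancel (by linarith), one_mul, hrr]
      _ ≤ _ := by gcongr
  obtain ⟨D, h1, h2, h3, h4⟩ := exists_circuit_detPoly ht0 htn R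
  refine ⟨D, h1, fun g => htl.trans (by exact_mod_cast h2 g), fun g => by rw [h3]; exact hb, ?_⟩
  have h5 : D.size ≤ n ^ (3 + 3 * (n / t + 2 * t)) := by
    refine h4.trans ?_
    rw [pow_add n, pow_mul n 3]
    have hn2 : 0 < n ^ 2 := by positivity
    have : n ^ 2 + 1 ≤ n ^ 3 := by nlinarith
    have : 25 * n ^ 2 ≤ n ^ 3 := by nlinarith
    gcongr
  have hlog : 0 ≤ Real.log n := Real.log_nonneg (by linarith)
  have h6 : ((3 + 3 * (n / t + 2 * t) : ℕ) : ℝ) ≤ (6 + 12 * K) * √(n : ℝ) := by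
    have : 1 / K * √(n : ℝ) ≤ 1 * √(n : ℝ) := by
      gcongr
      rw [div_le_one (by linarith)]
      exact hK
    push_cast
    linarith
  calc (D.size : ℝ) ≤ (n : ℝ) ^ (3 + 3 * (n / t + 2 * t)) := by exact_mod_cast h5
    _ = Real.exp (Real.log n * (3 + 3 * (n / t + 2 * t) : ℕ)) := by
        rw [← Real.rpow_natCast, Real.rpow_def_of_pos (by linarith)]
    _ ≤ Real.exp (Real.log n * ((6 + 12 * K) * √(n : ℝ))) := by gcongr
    -- Passing to base 2 doubles the constant, because `log 2 > 1 / 2`.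
    _ ≤ Real.exp (Real.log 2 * ((12 + 24 * K) * (√(n : ℝ) * Real.log n))) := by
        refine Real.exp_le_exp.2 ?_
        have := Real.log_two_gt_d9
        have h : 0 ≤ (6 + 12 * K) * (√(n : ℝ) * Real.log n) := by positivity
        nlinarith
    _ = _ := by rw [← Real.rpow_def_of_pos (by norm_num)]

theorem exists_isLeast_between {s : Set ℕ} {x y : ℝ} (hx : ∀ m ∈ s, x ≤ m)
    (hy : ∃ m ∈ s, (m : ℝ) ≤ y) : ∃ m, IsLeast s m ∧ x ≤ m ∧ (m : ℝ) ≤ y := by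
  obtain ⟨m, hm, hmy⟩ := hy
  have hl : IsLeast s (sInf s) := ⟨Nat.sInf_mem ⟨m, hm⟩, fun _ h => Nat.sInf_le h⟩
  exact ⟨sInf s, hl, hx _ hl.1, le_trans (by exact_mod_cast hl.2 hm) hmy⟩

theorem SPSPCircuit.size_pos {σ R : Type*} (C : SPSPCircuit σ R) : 0 < C.size :=
  Nat.succ_pos _

theorem two_rpow_le_of_mem_detSizesLevel3LE {c : ℝ} (hc : 0 < c) {n : ℕ} (hn : 9 ≤ n)
    (R : Type*) [CommRing R] [Nontrivial R] {s : ℕ}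
    (hs : s ∈ detSizesLevel3LE n R (c * √(n : ℝ))) :
    (2 : ℝ) ^ (1 / (2 * (c + 1)) * (√(n : ℝ) * Real.log n)) ≤ s := by
  obtain ⟨C, hC, hv, rfl⟩ := hs
  have h0 : 0 ≤ c * √(n : ℝ) := by positivity
  exact two_rpow_le_of_factorial_le hc hn (Nat.floor_le h0) C.size_pos
    (factorial_le_size_pow C hC _ fun _ _ g _ => Nat.le_floor (hv g))

theorem two_rpow_le_of_mem_detSizesBottomGE {c : ℝ} (hc : 0 < c) {n : ℕ} (hn : 9 ≤ n)
    (R : Type*) [CommRing R] [Nontrivial R] {s : ℕ}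
    (hs : s ∈ detSizesBottomGE n R (c * √(n : ℝ))) :
    (2 : ℝ) ^ (1 / (2 * (1 / c + 1)) * (√(n : ℝ) * Real.log n)) ≤ s := by
  obtain ⟨C, hC, ht, rfl⟩ := hs
  have h0 : 0 ≤ 1 / c * √(n : ℝ) := by positivity
  have hr : 0 < √(n : ℝ) := Real.sqrt_pos.2 (by exact_mod_cast (by omega : 0 < n))
  refine two_rpow_le_of_factorial_le (one_div_pos.2 hc) hn (Nat.floor_le h0) C.size_pos
    (factorial_le_size_pow C hC _ fun d hd g hg => Nat.le_floor ?_)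
  have h := C.level3FanIn_mul_le_degree _ ht g hg
  rw [hd] at h
  have hrr : √(n : ℝ) * √(n : ℝ) = n := Real.mul_self_sqrt (Nat.cast_nonneg n)
  rw [one_div_mul_eq_div, le_div_iff₀ hc]
  refine le_of_mul_le_mul_right ?_ hr
  rw [hrr, mul_assoc]
  exact h

theorem mainTheorem6 :
    (∀ c : ℝ, 0 < c → ∃ a b : ℝ, 0 < a ∧ 0 < b ∧ ∃ N : ℕ, ∀ n : ℕ, N ≤ n →
      ∀ (R : Type*) [CommRing R] [Nontrivial R],
        ∃ s : ℕ, IsLeast (detSizesBottomGE n R (c * √(n : ℝ))) s ∧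
          (2 : ℝ) ^ (a * (√(n : ℝ) * Real.log n)) ≤ s ∧
          (s : ℝ) ≤ (2 : ℝ) ^ (b * (√(n : ℝ) * Real.log n))) ∧
    (∀ c : ℝ, 0 < c → ∃ a b : ℝ, 0 < a ∧ 0 < b ∧ ∃ N : ℕ, ∀ n : ℕ, N ≤ n →
      ∀ (R : Type*) [CommRing R] [Nontrivial R],
        ∃ s : ℕ, IsLeast (detSizesLevel3LE n R (c * √(n : ℝ))) s ∧
          (2 : ℝ) ^ (a * (√(n : ℝ) * Real.log n)) ≤ s ∧
          (s : ℝ) ≤ (2 : ℝ) ^ (b * (√(n : ℝ) * Real.log n))) := by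
  -- With `K = max c (1 / c)` both `K ≥ c` and `1 / K ≤ c` hold, so the same circuit lies in both
  -- classes.
  have hmax (c : ℝ) (hc : 0 < c) : 1 ≤ max c (1 / c) := by
    rcases le_total 1 c with h | h
    · exact le_max_of_le_left h
    · exact le_max_of_le_right ((one_le_div hc).2 h)
  have hN (K : ℝ) (n : ℕ) (hn : 25 + ⌈4 * K ^ 2⌉₊ ≤ n) : 25 ≤ n ∧ 4 * K ^ 2 ≤ n :=
    ⟨by omega, (Nat.le_ceil _).trans (by exact_mod_cast (by omega : ⌈4 * K ^ 2⌉₊ ≤ n))⟩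
  constructor
  · intro c hc
    have hK := hmax c hc
    refine ⟨1 / (2 * (1 / c + 1)), 12 + 24 * max c (1 / c), by positivity, by positivity,
      25 + ⌈4 * max c (1 / c) ^ 2⌉₊, fun n hn R _ _ => ?_⟩
    obtain ⟨hn1, hn2⟩ := hN _ n hn
    refine exists_isLeast_between
      (fun m hm => two_rpow_le_of_mem_detSizesBottomGE hc (by omega) R hm) ?_
    obtain ⟨D, h1, h2, -, h4⟩ := exists_circuit_detPoly_sqrt hK hn1 hn2 R
    refine ⟨D.size, ⟨D, h1, fun g => le_trans ?_ (h2 g), rfl⟩, h4⟩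
    gcongr
    exact le_max_left _ _
  · intro c hc
    have hK := hmax c hc
    refine ⟨1 / (2 * (c + 1)), 12 + 24 * max c (1 / c), by positivity, by positivity,
      25 + ⌈4 * max c (1 / c) ^ 2⌉₊, fun n hn R _ _ => ?_⟩
    obtain ⟨hn1, hn2⟩ := hN _ n hn
    refine exists_isLeast_between
      (fun m hm => two_rpow_le_of_mem_detSizesLevel3LE hc (by omega) R hm) ?_
    obtain ⟨D, h1, -, h3, h4⟩ := exists_circuit_detPoly_sqrt hK hn1 hn2 R
    refine ⟨D.size, ⟨D, h1, fun g => (h3 g).trans ?_, rfl⟩, h4⟩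
    gcongr
    rw [one_div_le (by linarith) hc]
    exact le_max_right _ _
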